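/- **Setting.** Let $\mathcal K$ be the set of open double cones $\mathcal O=(a+V_+)\cap(b-V_+)$, $b-a\in V_+$ ($V_+$ the open forward light cone), in Minkowski space with at least two space dimensions, ordered by inclusion; write $\mathcal O_1\subset\mathcal O'$ if $\mathcal O_1$ is spacelike to $\mathcal O$. A $\mathbb Z_2$-graded net $\mathfrak F,k,\mathcal H$ consists of von Neumann algebras $\mathfrak F(\mathcal O)$, $\mathcal O\in\mathcal K$, on a complex Hilbert space $\mathcal H$, with $\mathfrak F(\mathcal O_1)\subset\mathfrak F(\mathcal O_2)$ for $\mathcal O_1\subset\mathcal O_2$, and a unitary $k$ with $k^2=1$ and $k\mathfrak F(\mathcal O)k=\mathfrak F(\mathcal O)$ for all $\mathcal O$. For a family $\mathfrak S$ of $k$-invariant linear spaces of operators $\mathfrak S(\mathcal O)$, $\mathcal O\in\mathcal K$, let $\mathfrak S_\pm(\mathcal O)=\{S\in\mathfrak S(\mathcal O): kSk=\pm S\}$, $\mathfrak S^t=\mathfrak S_++ik\,\mathfrak S_-$, and let the twisted dual be $$\mathfrak S^d(\mathcal O)=\bigcap_{\mathcal O_1\subset\mathcal O'}\mathfrak S^t(\mathcal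 O_1)'.$$ For a net $\mathfrak F$, $\mathfrak F^d$ is again a $\mathbb Z_2$-graded net with the same $\mathcal H$ and $k$. For a projection $E$ commuting with $k$, $E\mathfrak SE$ is the family $\mathcal O\mapsto E\mathfrak S(\mathcal O)E$ on $\mathcal H$, and ${}_E\mathfrak S$ is its restriction to $E\mathcal H$; duals of families on $E\mathcal H$ are formed on $E\mathcal H$ with $k|_{E\mathcal H}$ in place of $k$. $E$ is cyclic for $\mathfrak S$ if $\mathfrak S(\mathcal O)E\mathcal H$ spans a dense subspace of $\mathcal H$ for every $\mathcal O$. A conditional expectation on a net is a family of conditional expectations of the algebras $\mathfrak F(\mathcal O)$ (unital positive idempotent linear maps of $\mathfrak F(\mathcal O)$ to itself that are bimodule maps over their range) compatible with the inclusions $\mathfrak F(\mathcal O_1)\subset\mathfrak F(\mathcal O_2)$. **Corollary 3.3.** Let $\mathfrak F=\mathfrak F^{dd},k,\mathcal H$ be a $\mathbb Z_2$-graded net and $E$ a projection on $\mathcal H$ commuting with $k$ and cyclic for $\mathfrak F$ and for $\mathfrak F^d$. Then the following conditions are equivalent. - a) There is a conditional expectation $m$ on $\mathfrak F$ such that $m(F)E=EFE$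 for all $F\in\mathfrak F$. - a$'$) There is a conditional expectation $m^d$ on $\mathfrak F^d$ such that $m^d(F)E=EFE$ for all $F\in\mathfrak F^d$. - b) $E\mathfrak FE\subset(E\mathfrak F^dE)^d$. - b$'$) $E\mathfrak F^dE\subset(E\mathfrak FE)^d$. - c) $({}_E\mathfrak F)^d={}_E(\mathfrak F^d)$. - c$'$) $({}_E(\mathfrak F^d))^d={}_E\mathfrak F$. -/

import Mathlib

noncomputable section

/-- Minkowski space with one time dimension and `d` space dimensions. -/
abbrev Minkowski (d : ℕ) : Type := ℝ × EuclideanSpace ℝ (Fin d)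

namespace Minkowski

/-- The open forward light cone `V₊`. -/
def forwardCone (d : ℕ) : Set (Minkowski d) := {x | ‖x.2‖ < x.1}

/-- The double cone `(a + V₊) ∩ (b - V₊)` with vertices `a` and `b`. -/
def doubleConeSet {d : ℕ} (a b : Minkowski d) : Set (Minkowski d) :=
  {x | x - a ∈ forwardCone d ∧ b - x ∈ forwardCone d}

/-- The causal complement `S'`: all points that are spacelike to every point of `S`. -/
def causalComplement {d : ℕ} (S : Set (Minkowski d)) : Set (Minkowski d) :=
  {x | ∀ y ∈ S, |x.1 - y.1| < ‖x.2 - y.2‖}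

end Minkowski

/-- The set `𝒦` of (nonempty, open) double cones in Minkowski space; as a subtype of
`Set (Minkowski d)` it is ordered under inclusion. -/
abbrev DoubleCone (d : ℕ) : Type :=
  {O : Set (Minkowski d) //
    ∃ a b : Minkowski d, b - a ∈ Minkowski.forwardCone d ∧ O = Minkowski.doubleConeSet a b}

/-- `O₁ ⊂ O'`: the double cone `O₁` lies in the causal complement of `O`. -/
def DoubleCone.Spacelike {d : ℕ} (O₁ O : DoubleCone d) : Prop :=
  O₁.1 ⊆ Minkowski.causalComplement O.1

section OperatorNets

/-! Families of sets of bounded operators indexed by double cones, on a (pre-)Hilbert space `H`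
with an involution `k`. They need not consist of algebras. -/

variable {d : ℕ} {H : Type*} [NormedAddCommGroup H] [InnerProductSpace ℂ H]

/-- The twist `S₊ + i k S₋` of a set `S` of operators, where `S₊` (`S₋`) is the set of those
`A ∈ S` with `k A k = A` (`k A k = -A`). -/
def twist (k : H →L[ℂ] H) (S : Set (H →L[ℂ] H)) : Set (H →L[ℂ] H) :=
  {X | ∃ A ∈ S, ∃ B ∈ S, k * A * k = A ∧ k * B * k = -B ∧ X = A + Complex.I • (k * B)}

/-- The twisted dual `O ↦ ⋂_{O₁ ⊂ O'} Sᵗ(O₁)'` of a family `S` of sets of operators. -/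
def twistedDual (k : H →L[ℂ] H) (S : DoubleCone d → Set (H →L[ℂ] H)) :
    DoubleCone d → Set (H →L[ℂ] H) :=
  fun O => ⋂ O₁ : DoubleCone d, ⋂ _ : O₁.Spacelike O, Set.centralizer (twist k (S O₁))

/-- The family `E S E`, acting on `H`. -/
def corner (E : H →L[ℂ] H) (S : DoubleCone d → Set (H →L[ℂ] H)) :
    DoubleCone d → Set (H →L[ℂ] H) :=
  fun O => (fun A => E * A * E) '' S O

/-- The restriction of `E A E` to the subspace `E H`, as an operator on `E H`. -/
def compress (E A : H →L[ℂ] H) : E.range →L[ℂ] E.range :=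
  E.rangeRestrict ∘L A ∘L E.range.subtypeL

theorem coe_compress_apply (E A : H →L[ℂ] H) (hE : E * E = E) (x : E.range) :
    (compress E A x : H) = (E * A * E) (x : H) := by
  obtain ⟨_, y, rfl⟩ := x
  have h : E (E y) = E y := congrArg (fun T : H →L[ℂ] H => T y) hE
  simp [compress, h]

/-- The family `_E S` of operators on `E H`: the restriction of `E S E` to `E H`. -/
def compressedNet (E : H →L[ℂ] H) (S : DoubleCone d → Set (H →L[ℂ] H)) :
    DoubleCone d → Set (E.range →L[ℂ] E.range) :=
  fun O => compress E '' S O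

/-- `E` is cyclic for the family `S`: for each `O`, the vectors `A E x` with `A ∈ S O` and `x ∈ H`
span a dense subspace of `H`. -/
def IsCyclicFor (E : H →L[ℂ] H) (S : DoubleCone d → Set (H →L[ℂ] H)) : Prop :=
  ∀ O, (Submodule.span ℂ {y : H | ∃ A ∈ S O, ∃ x : H, y = A (E x)}).topologicalClosure = ⊤

end OperatorNets

/-- A (concrete) `ℤ₂`-graded net: a net of von Neumann algebras over the double cones, on the
Hilbert space `H`, with an involutive unitary `k` inducing an automorphism of the net. -/
structure GradedNet (d : ℕ) (H : Type*) [NormedAddCommGroup H] [InnerProductSpace ℂ H]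
    [CompleteSpace H] where
  algebra : DoubleCone d → VonNeumannAlgebra H
  isotony : ∀ O₁ O₂ : DoubleCone d, O₁ ≤ O₂ → algebra O₁ ≤ algebra O₂
  k : H →L[ℂ] H
  k_unitary : k ∈ unitary (H →L[ℂ] H)
  k_mul_k : k * k = 1
  k_conj_mem : ∀ (O : DoubleCone d), ∀ A ∈ algebra O, k * A * k ∈ algebra O

namespace GradedNet

variable {d : ℕ} {H : Type*} [NormedAddCommGroup H] [InnerProductSpace ℂ H] [CompleteSpace H]

/-- The underlying family of sets of operators. -/
def sets (F : GradedNet d H) : DoubleCone d → Set (H →L[ℂ] H) :=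
  fun O => (F.algebra O : Set (H →L[ℂ] H))

theorem star_k (F : GradedNet d H) : star F.k = F.k := by
  have h := (Unitary.mem_iff.1 F.k_unitary).1
  calc star F.k = star F.k * (F.k * F.k) := by rw [F.k_mul_k, mul_one]
    _ = F.k := by rw [← mul_assoc, h, one_mul]

theorem star_mem_twist (F : GradedNet d H) (O : DoubleCone d) {X : H →L[ℂ] H}
    (hX : X ∈ twist F.k (F.sets O)) : star X ∈ twist F.k (F.sets O) := by
  obtain ⟨A, hA, B, hB, hAk, hBk, rfl⟩ := hX
  have hB' : F.k * star B * F.k = -star B := by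
    have := congrArg star hBk
    simpa [F.star_k, mul_assoc] using this
  refine ⟨star A, star_mem (S := VonNeumannAlgebra H) hA, star B,
    star_mem (S := VonNeumannAlgebra H) hB, ?_, hB', ?_⟩
  · have := congrArg star hAk
    simpa [F.star_k, mul_assoc] using this
  · have h2 : star B * F.k = -(F.k * star B) := by
      calc star B * F.k = F.k * F.k * star B * F.k := by rw [F.k_mul_k, one_mul]
        _ = F.k * (F.k * star B * F.k) := by simp only [mul_assoc]
        _ = -(F.k * star B) := by rw [hB', mul_neg]
    rw [star_add, star_smul, star_mul, F.star_k, h2]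
    simp

theorem conj_mem_twist (F : GradedNet d H) (O : DoubleCone d) {X : H →L[ℂ] H}
    (hX : X ∈ twist F.k (F.sets O)) : F.k * X * F.k ∈ twist F.k (F.sets O) := by
  obtain ⟨A, hA, B, hB, hAk, hBk, rfl⟩ := hX
  refine ⟨A, hA, -B, neg_mem (S := VonNeumannAlgebra H) hB, hAk, by simp [hBk], ?_⟩
  rw [mul_add, add_mul, hAk, mul_smul_comm, smul_mul_assoc]
  congr 2
  rw [mul_assoc, hBk]

theorem twistedDual_eq (F : GradedNet d H) (O : DoubleCone d) :
    twistedDual F.k F.sets O =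
      (⋃ O₁ : DoubleCone d, ⋃ _ : O₁.Spacelike O, twist F.k (F.sets O₁)).centralizer := by
  ext X
  simp only [twistedDual, Set.mem_iInter, Set.mem_centralizer_iff, Set.mem_iUnion]
  exact ⟨fun h Y ⟨O₁, h₁, hY⟩ => h O₁ h₁ Y hY, fun h O₁ h₁ Y hY => h Y ⟨O₁, h₁, hY⟩⟩

/-- The twisted dual net `F^d`, with `F^d(O) = ⋂_{O₁ ⊂ O'} Fᵗ(O₁)'`, as a `ℤ₂`-graded net on the
same Hilbert space with the same `k`. -/
def dual (F : GradedNet d H) : GradedNet d H where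
  algebra O :=
    { carrier := twistedDual F.k F.sets O
      mul_mem' := by
        intro a b ha hb
        rw [twistedDual_eq] at *
        exact Set.mul_mem_centralizer ha hb
      one_mem' := by
        rw [twistedDual_eq]
        exact Set.one_mem_centralizer
      add_mem' := by
        intro a b ha hb
        rw [twistedDual_eq] at *
        exact Set.add_mem_centralizer ha hb
      zero_mem' := by
        rw [twistedDual_eq]
        exact Set.zero_mem_centralizer
      algebraMap_mem' := by
        intro c
        rw [twistedDual_eq]
        exact fun a _ => (Algebra.commutes c a).symm
      star_mem' := by
        intro a ha
        rw [twistedDual_eq] at *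
        refine Set.star_mem_centralizer' (fun Y hY => ?_) ha
        simp only [Set.mem_iUnion] at hY ⊢
        obtain ⟨O₁, h₁, hY⟩ := hY
        exact ⟨O₁, h₁, F.star_mem_twist O₁ hY⟩
      centralizer_centralizer' := by
        show Set.centralizer (Set.centralizer (twistedDual F.k F.sets O)) = _
        rw [twistedDual_eq]
        exact Set.centralizer_centralizer_centralizer _ }
  isotony O₁ O₂ h X hX := by
    change X ∈ twistedDual F.k F.sets O₁ at hX
    change X ∈ twistedDual F.k F.sets O₂
    simp only [twistedDual, Set.mem_iInter] at hX ⊢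
    exact fun O₃ h₃ => hX O₃ fun x hx y hy => h₃ hx y (h hy)
  k := F.k
  k_unitary := F.k_unitary
  k_mul_k := F.k_mul_k
  k_conj_mem O X hX := by
    change X ∈ twistedDual F.k F.sets O at hX
    change _ ∈ twistedDual F.k F.sets O
    simp only [twistedDual, Set.mem_iInter, Set.mem_centralizer_iff] at hX ⊢
    intro O₁ h₁ Y hY
    have h := hX O₁ h₁ _ (F.conj_mem_twist O₁ hY)
    calc Y * (F.k * X * F.k)
        = (F.k * F.k) * Y * (F.k * X * F.k) := by rw [F.k_mul_k, one_mul]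
      _ = F.k * ((F.k * Y * F.k) * X) * F.k := by simp only [mul_assoc]
      _ = F.k * X * F.k * Y * (F.k * F.k) := by rw [h]; simp only [mul_assoc]
      _ = F.k * X * F.k * Y := by rw [F.k_mul_k, mul_one]

theorem dual_sets (F : GradedNet d H) : F.dual.sets = twistedDual F.k F.sets := rfl

end GradedNet

section ConditionalExpectation

variable {d : ℕ} {H : Type*} [NormedAddCommGroup H] [InnerProductSpace ℂ H] [CompleteSpace H]

/-- A linear map `m : M → M` on a von Neumann algebra is a conditional expectation (onto its range,
which these axioms make a unital `*`-subalgebra) if it is an idempotent unital positive map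
that has the bimodule property over its range. -/
structure IsConditionalExpectation (M : VonNeumannAlgebra H)
    (m : M.toStarSubalgebra →ₗ[ℂ] M.toStarSubalgebra) : Prop where
  idem : ∀ X, m (m X) = m X
  map_one : m 1 = 1
  pos : ∀ X : M.toStarSubalgebra, (X : H →L[ℂ] H).IsPositive → (m X : H →L[ℂ] H).IsPositive
  bimodule : ∀ X Y Z, m (m X * Y * m Z) = m X * m Y * m Z

/-- A conditional expectation of a net: a family of conditional expectations of the local algebras
that is compatible with the inclusions `F(O₁) ⊂ F(O₂)`. -/
structure NetConditionalExpectation (F : GradedNet d H) where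
  map : ∀ O, (F.algebra O).toStarSubalgebra →ₗ[ℂ] (F.algebra O).toStarSubalgebra
  isConditionalExpectation : ∀ O, IsConditionalExpectation (F.algebra O) (map O)
  compatible : ∀ (O₁ O₂ : DoubleCone d) (h : O₁ ≤ O₂) (X : (F.algebra O₁).toStarSubalgebra),
    (map O₂ ⟨X, F.isotony O₁ O₂ h X.2⟩ : H →L[ℂ] H) = map O₁ X

/-- The net `F` has a conditional expectation `m` with `m(A) E = E A E` for all `A` in `F`. -/
def HasConditionalExpectationFor (F : GradedNet d H) (E : H →L[ℂ] H) : Prop :=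
  ∃ m : NetConditionalExpectation F, ∀ (O : DoubleCone d) (A : (F.algebra O).toStarSubalgebra),
    (m.map O A : H →L[ℂ] H) * E = E * (A : H →L[ℂ] H) * E

end ConditionalExpectation

end

/-! All six conditions are equivalent to one commutation property, `CornersCommute`: `E F^d(O) E`
commutes with `E Fᵗ(O₁) E` whenever `O₁ ⊂ O'`. Twisted commutation is symmetric
(`commute_twist_symm`), so `F^dd = F` makes the property invariant under exchanging `F` and `F^d`,
and each pair of conditions needs only one proof.

The substance is `exists_mem_dual_extension`: an operator `X` on `E H` commuting with all these `E
Fᵗ(O₁) E` extends to an element of `F^d(O)`. For a single `O₁`, the rule `A E x ↦ A X x` is bounded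
on a dense subspace (`norm_dilationMap_le`) and gives `T` in `Fᵗ(O₁)'`. By cyclicity `T` is
determined by `T E = X`, so it does not change when `O₁` shrinks. In at least two space dimensions
the causal complement of `O` is connected, so all `O₁` give the same `T`
(`DoubleCone.eq_of_spacelike`).

Applied to arbitrary `X` this yields the nontrivial inclusion in the compressed duality; applied to
`X = E A E` it yields `m(A)`. Conversely, `m(A)` commutes with `E` and with `Fᵗ(O₁)`, which forces
the corners to commute. -/

noncomputable section

/-! ### Connectedness of the exterior of an ellipsoid. -/

section EllipsoidExterior

variable {V : Type*} [NormedAddCommGroup V] [NormedSpace ℝ V]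

/-- Each of `v ∓ h` is a combination of `t • v - h` and `t • v + h` whose coefficients have absolute
values `(1 ± t⁻¹) / 2`, and these add up to one. Hence the exterior of an ellipsoid is stable under
moving outwards along rays. -/
theorem norm_sub_add_norm_add_le_smul (h v : V) {t : ℝ} (ht : 1 ≤ t) :
    ‖v - h‖ + ‖v + h‖ ≤ ‖t • v - h‖ + ‖t • v + h‖ := by
  have ht0 : (0 : ℝ) < t := by linarith
  have hinv : t⁻¹ ≤ 1 := inv_le_one_of_one_le₀ ht
  have hinv0 : 0 < t⁻¹ := inv_pos.2 ht0
  have key : ∀ k : V, ‖v - k‖ ≤ (1 + t⁻¹) / 2 * ‖t • v - k‖ + (1 - t⁻¹) / 2 * ‖t • v + k‖ := by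
    intro k
    have hv : v - k = ((1 + t⁻¹) / 2) • (t • v - k) - ((1 - t⁻¹) / 2) • (t • v + k) := by
      match_scalars <;> field_simp <;> ring
    calc ‖v - k‖ = ‖((1 + t⁻¹) / 2) • (t • v - k) - ((1 - t⁻¹) / 2) • (t • v + k)‖ := by
          rw [← hv]
      _ ≤ _ := norm_sub_le _ _
      _ = _ := by
          rw [norm_smul, norm_smul, Real.norm_of_nonneg (by linarith),
            Real.norm_of_nonneg (by linarith)]
  have h1 := key h
  have h2 := key (-h)
  rw [sub_neg_eq_add, sub_neg_eq_add, ← sub_eq_add_neg] at h2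
  linarith

theorem two_mul_norm_le_norm_sub_add_norm_add (h v : V) : 2 * ‖v‖ ≤ ‖v - h‖ + ‖v + h‖ := by
  have hv : (2 : ℝ) • v = (v - h) + (v + h) := by rw [two_smul]; abel
  calc 2 * ‖v‖ = ‖(2 : ℝ) • v‖ := by rw [norm_smul]; norm_num
    _ ≤ _ := hv ▸ norm_add_le _ _

/-- In dimension at least two, the exterior of a (centered) ellipsoid is preconnected. -/
theorem isPreconnected_centered_ellipsoid_exterior (hV : 1 < Module.rank ℝ V) (h : V) {r : ℝ}
    (hr : 2 * ‖h‖ < r) : IsPreconnected {v : V | r < ‖v - h‖ + ‖v + h‖} := by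
  have hr0 : 0 < r := lt_of_le_of_lt (by positivity) hr
  have ray : ∀ v : V, r < ‖v - h‖ + ‖v + h‖ → ∀ R : ℝ, ‖v‖ ≤ R →
      ∃ s ⊆ {v : V | r < ‖v - h‖ + ‖v + h‖}, IsPreconnected s ∧ v ∈ s ∧
        ∃ w ∈ s, w ∈ Metric.sphere (0 : V) R := by
    intro v hv R hR
    have hv0 : v ≠ 0 := by
      rintro rfl
      rw [zero_sub, zero_add, norm_neg] at hv
      linarith
    have hvn : 0 < ‖v‖ := norm_pos_iff.2 hv0
    have h1 : 1 ≤ R / ‖v‖ := (one_le_div hvn).2 hR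
    refine ⟨(fun t : ℝ => t • v) '' Set.Icc 1 (R / ‖v‖), ?_, ?_, ⟨1, ⟨le_rfl, h1⟩, one_smul _ _⟩,
      (R / ‖v‖) • v, ⟨_, ⟨h1, le_rfl⟩, rfl⟩, ?_⟩
    · rintro _ ⟨t, ht, rfl⟩
      exact hv.trans_le (norm_sub_add_norm_add_le_smul h v ht.1)
    · exact isPreconnected_Icc.image _ (by fun_prop)
    · rw [mem_sphere_zero_iff_norm, norm_smul, Real.norm_of_nonneg (by linarith)]
      field_simp
  refine isPreconnected_of_forall_pair fun v hv w hw => ?_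
  -- The sphere of radius `R ≥ r` joins the two rays inside the exterior, since `2 * R > r`.
  obtain ⟨R, hRv, hRw, hRr⟩ : ∃ R, ‖v‖ ≤ R ∧ ‖w‖ ≤ R ∧ r ≤ R :=
    ⟨max ‖v‖ (max ‖w‖ r), by simp, by simp, by simp⟩
  obtain ⟨s, hs, hsc, hvs, x, hxs, hx⟩ := ray v hv R hRv
  obtain ⟨s', hs', hsc', hws, y, hys, hy⟩ := ray w hw R hRw
  have hsph := isPreconnected_sphere hV (0 : V) R
  refine ⟨s ∪ Metric.sphere 0 R ∪ s', ?_, Or.inl (Or.inl hvs), Or.inr hws, ?_⟩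
  · refine Set.union_subset (Set.union_subset hs fun z hz => ?_) hs'
    have := two_mul_norm_le_norm_sub_add_norm_add h z
    rw [mem_sphere_zero_iff_norm] at hz
    show r < _
    linarith
  · exact (hsc.union x hxs hx hsph).union y (Or.inr hy) hys hsc'

/-- In dimension at least two, the exterior of an ellipsoid with foci `a` and `b` is
preconnected. -/
theorem isPreconnected_ellipsoid_exterior (hV : 1 < Module.rank ℝ V) (a b : V) {r : ℝ}
    (hr : ‖b - a‖ < r) : IsPreconnected {p : V | r < ‖p - a‖ + ‖p - b‖} := by
  have hhalf : 2 * ‖(1 / 2 : ℝ) • (a - b)‖ < r := by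
    rw [norm_smul, norm_sub_rev]
    norm_num
    linarith
  have hc := (isPreconnected_centered_ellipsoid_exterior hV _ hhalf).image
    (fun v => v + (1 / 2 : ℝ) • (a + b)) (by fun_prop)
  convert hc using 1
  ext p
  have h1 : p - (1 / 2 : ℝ) • (a + b) - (1 / 2 : ℝ) • (a - b) = p - a := by
    match_scalars <;> norm_num
  have h2 : p - (1 / 2 : ℝ) • (a + b) + (1 / 2 : ℝ) • (a - b) = p - b := by
    match_scalars <;> norm_num
  constructor
  · intro hp
    exact ⟨p - (1 / 2 : ℝ) • (a + b), by rw [Set.mem_ofPred_eq, h1, h2]; exact hp, by simp⟩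
  · rintro ⟨v, hv, rfl⟩
    rw [add_sub_cancel_right] at h1 h2
    rw [Set.mem_ofPred_eq] at hv ⊢
    beta_reduce at h1 h2 ⊢
    rwa [← h1, ← h2]

theorem ellipsoid_exterior_nonempty [Nontrivial V] (a b : V) (r : ℝ) :
    {p : V | r < ‖p - a‖ + ‖p - b‖}.Nonempty := by
  obtain ⟨p, hp⟩ := NormedSpace.exists_lt_norm ℝ V (r + ‖a‖)
  refine ⟨p, ?_⟩
  have h1 := norm_sub_norm_le p a
  have h2 := norm_nonneg (p - b)
  show r < _
  linarith

end EllipsoidExterior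

/-! ### Double cones and their spacelike regions. -/

namespace Minkowski

variable {d : ℕ}

theorem mem_doubleConeSet {a b x : Minkowski d} :
    x ∈ doubleConeSet a b ↔ ‖x.2 - a.2‖ < x.1 - a.1 ∧ ‖b.2 - x.2‖ < b.1 - x.1 :=
  Iff.rfl

theorem isOpen_doubleConeSet (a b : Minkowski d) : IsOpen (doubleConeSet a b) := by
  have h : doubleConeSet a b =
      {x | ‖x.2 - a.2‖ < x.1 - a.1} ∩ {x | ‖b.2 - x.2‖ < b.1 - x.1} := rfl
  rw [h]
  exact (isOpen_lt (by fun_prop) (by fun_prop)).inter (isOpen_lt (by fun_prop) (by fun_prop))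

theorem doubleConeSet_subset {a b c e : Minkowski d} (hac : ‖c.2 - a.2‖ ≤ c.1 - a.1)
    (heb : ‖b.2 - e.2‖ ≤ b.1 - e.1) : doubleConeSet c e ⊆ doubleConeSet a b := by
  intro x hx
  rw [mem_doubleConeSet] at hx ⊢
  constructor
  · linarith [norm_sub_le_norm_sub_add_norm_sub x.2 c.2 a.2]
  · linarith [norm_sub_le_norm_sub_add_norm_sub b.2 e.2 x.2]

/-- The points that are spacelike to the closed double cone with vertices `a` and `b`. -/
def spacelikeRegion (a b : Minkowski d) : Set (Minkowski d) :=
  {p | p.1 - a.1 < ‖p.2 - a.2‖ ∧ b.1 - p.1 < ‖p.2 - b.2‖}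

/-- The spacelike region is the image of a product of preconnected sets: its fibers over the
exterior of an ellipsoid in space are intervals in time. -/
theorem spacelikeRegion_eq_image (a b : Minkowski d) :
    spacelikeRegion a b =
      (fun q : EuclideanSpace ℝ (Fin d) × ℝ =>
        (((1 - q.2) * (b.1 - ‖q.1 - b.2‖) + q.2 * (a.1 + ‖q.1 - a.2‖), q.1) : Minkowski d)) ''
        ({p | b.1 - a.1 < ‖p - a.2‖ + ‖p - b.2‖} ×ˢ Set.Ioo 0 1) := by
  ext p
  constructor
  · rintro ⟨h1, h2⟩
    have hpos : 0 < (a.1 + ‖p.2 - a.2‖) - (b.1 - ‖p.2 - b.2‖) := by linarith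
    refine ⟨(p.2, (p.1 - (b.1 - ‖p.2 - b.2‖)) /
      ((a.1 + ‖p.2 - a.2‖) - (b.1 - ‖p.2 - b.2‖))), ⟨?_, ?_, ?_⟩, ?_⟩
    · show b.1 - a.1 < _
      linarith
    · exact div_pos (by linarith) hpos
    · exact (div_lt_one hpos).2 (by linarith)
    · refine Prod.ext ?_ rfl
      have := hpos.ne'
      dsimp only
      field_simp
      ring
  · rintro ⟨⟨x, t⟩, ⟨hx, ht0, ht1⟩, rfl⟩
    have hx' : b.1 - a.1 < ‖x - a.2‖ + ‖x - b.2‖ := hx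
    have ht0' : 0 < t := ht0
    have ht1' : t < 1 := ht1
    constructor <;> dsimp only <;> nlinarith

theorem isPreconnected_spacelikeRegion (hd : 2 ≤ d) {a b : Minkowski d}
    (hab : b - a ∈ forwardCone d) : IsPreconnected (spacelikeRegion a b) := by
  rw [spacelikeRegion_eq_image]
  have hrank : 1 < Module.rank ℝ (EuclideanSpace ℝ (Fin d)) := by
    rw [← Module.finrank_eq_rank, finrank_euclideanSpace_fin]
    exact_mod_cast hd
  exact ((isPreconnected_ellipsoid_exterior hrank a.2 b.2 hab).prod isPreconnected_Ioo).image _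
    (by fun_prop)

theorem spacelikeRegion_nonempty (hd : 1 ≤ d) (a b : Minkowski d) :
    (spacelikeRegion a b).Nonempty := by
  rw [spacelikeRegion_eq_image]
  have : NeZero d := ⟨by omega⟩
  exact ((ellipsoid_exterior_nonempty a.2 b.2 _).prod (Set.nonempty_Ioo.2 one_pos)).image _

end Minkowski

/-! ### Connectedness of the set of double cones spacelike to a given one. -/

namespace DoubleCone

open Minkowski Topology

variable {d : ℕ}

theorem Spacelike.symm {O₁ O : DoubleCone d} (h : O₁.Spacelike O) : O.Spacelike O₁ := by
  intro x hx y hy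
  rw [abs_sub_comm, norm_sub_rev]
  exact h hy x hx

theorem Spacelike.mono_left {O₁ O₂ O : DoubleCone d} (h : O₂.Spacelike O) (h₁ : O₁ ≤ O₂) :
    O₁.Spacelike O :=
  fun _ hx => h (h₁ hx)

theorem nonempty (O : DoubleCone d) : O.1.Nonempty := by
  obtain ⟨_, a, b, hab, rfl⟩ := O
  have hab' : ‖b.2 - a.2‖ < b.1 - a.1 := hab
  refine ⟨(1 / 2 : ℝ) • (a + b), ?_⟩
  have h1 : (1 / 2 : ℝ) • (a.2 + b.2) - a.2 = (1 / 2 : ℝ) • (b.2 - a.2) := by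
    match_scalars <;> norm_num
  have h2 : b.2 - (1 / 2 : ℝ) • (a.2 + b.2) = (1 / 2 : ℝ) • (b.2 - a.2) := by
    match_scalars <;> norm_num
  rw [mem_doubleConeSet]
  simp only [Prod.smul_fst, Prod.smul_snd, Prod.fst_add, Prod.snd_add, h1, h2, norm_smul]
  norm_num
  constructor <;> linarith

/-- If some `x` and `y` were causally related, the chain from a past vertex through `y` and `x` to
the opposite future vertex would be timelike. -/
theorem spacelike_of_vertices {O₁ O : DoubleCone d} {a b c e : Minkowski d}
    (hO : O.1 = doubleConeSet a b) (hO₁ : O₁.1 = doubleConeSet c e)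
    (h1 : e.1 - a.1 ≤ ‖e.2 - a.2‖) (h2 : b.1 - c.1 ≤ ‖c.2 - b.2‖) : O₁.Spacelike O := by
  intro x hx y hy
  rw [hO, mem_doubleConeSet] at hy
  rw [hO₁, mem_doubleConeSet] at hx
  by_contra! hxy
  rcases le_abs.1 hxy with h | h
  · linarith [norm_sub_le_norm_sub_add_norm_sub e.2 x.2 a.2,
      norm_sub_le_norm_sub_add_norm_sub x.2 y.2 a.2]
  · have e1 := norm_sub_le_norm_sub_add_norm_sub b.2 y.2 c.2
    have e2 := norm_sub_le_norm_sub_add_norm_sub y.2 x.2 c.2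
    rw [norm_sub_rev y.2 x.2] at e2
    rw [norm_sub_rev c.2 b.2] at h2
    linarith

/-- True at `η = 0`, hence for small `η` as the cone is open. It replaces a vertex, which is not in
the open double cone, by a nearby interior point. -/
theorem exists_sub_smul_mem_forwardCone {u v : Minkowski d} (hu : u ∈ forwardCone d)
    (hv : ‖v.2‖ ≤ v.1) (w : Minkowski d) :
    ∃ η : ℝ, 0 < η ∧ η < 1 ∧ (1 / 2 : ℝ) • u + v - η • w ∈ forwardCone d := by
  have hopen : IsOpen {η : ℝ | ‖((1 / 2 : ℝ) • u + v - η • w).2‖ <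
      ((1 / 2 : ℝ) • u + v - η • w).1} := isOpen_lt (by fun_prop) (by fun_prop)
  have h0 : (0 : ℝ) ∈ {η : ℝ | ‖((1 / 2 : ℝ) • u + v - η • w).2‖ <
      ((1 / 2 : ℝ) • u + v - η • w).1} := by
    have hu' : ‖u.2‖ < u.1 := hu
    have h := norm_add_le ((1 / 2 : ℝ) • u.2) v.2
    rw [norm_smul, Real.norm_of_nonneg (by norm_num)] at h
    simp only [Set.mem_ofPred_eq, zero_smul, sub_zero, Prod.snd_add, Prod.fst_add,
      Prod.smul_fst, Prod.smul_snd, smul_eq_mul]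
    linarith
  have hev : ∀ᶠ η : ℝ in 𝓝[>] 0, (1 / 2 : ℝ) • u + v - η • w ∈ forwardCone d :=
    nhdsWithin_le_nhds (hopen.mem_nhds h0)
  obtain ⟨η, h1, h2⟩ := (hev.and (Ioo_mem_nhdsGT (zero_lt_one' ℝ))).exists
  exact ⟨η, h2.1, h2.2, h1⟩

theorem smul_vertices_mem {a b : Minkowski d} (hab : b - a ∈ forwardCone d) {η : ℝ}
    (h0 : 0 < η) (h1 : η < 1) : a + η • (b - a) ∈ doubleConeSet a b := by
  have hab' : ‖b.2 - a.2‖ < b.1 - a.1 := hab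
  have e1 : a.2 + η • (b.2 - a.2) - a.2 = η • (b.2 - a.2) := by abel
  have e2 : b.2 - (a.2 + η • (b.2 - a.2)) = (1 - η) • (b.2 - a.2) := by
    match_scalars <;> ring
  rw [mem_doubleConeSet]
  simp only [Prod.fst_add, Prod.snd_add, Prod.smul_fst, Prod.smul_snd, Prod.fst_sub,
    Prod.snd_sub, smul_eq_mul, e1, e2, norm_smul, Real.norm_eq_abs, abs_of_pos h0,
    abs_of_pos (sub_pos.2 h1)]
  constructor <;> nlinarith

theorem Spacelike.subset_spacelikeRegion {O₁ O : DoubleCone d} (h : O₁.Spacelike O)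
    {a b : Minkowski d} (hab : b - a ∈ forwardCone d) (hO : O.1 = doubleConeSet a b) :
    O₁.1 ⊆ spacelikeRegion a b := by
  obtain ⟨_, c, e, hce, rfl⟩ := O₁
  intro p hp
  constructor
  -- If `p` is in the causal future of `a`, then the midpoint of `p` and `e` is in the timelike
  -- future of points of `O` close to `a`.
  · by_contra! hcon
    obtain ⟨η, h0, h1, hlt⟩ :=
      exists_sub_smul_mem_forwardCone hp.2 (v := p - a) hcon (b - a)
    have hx : p + (1 / 2 : ℝ) • (e - p) ∈ doubleConeSet c e :=
      doubleConeSet_subset hp.1.le (by simp)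
        (smul_vertices_mem hp.2 (by norm_num) (by norm_num))
    have hs := h hx _ (hO ▸ smul_vertices_mem hab h0 h1)
    have hxy : (1 / 2 : ℝ) • (e - p) + (p - a) - η • (b - a) =
        p + (1 / 2 : ℝ) • (e - p) - (a + η • (b - a)) := by abel
    rw [hxy] at hlt
    exact absurd (hs.trans hlt) (not_lt.2 (le_abs_self _))
  · by_contra! hcon
    rw [norm_sub_rev] at hcon
    obtain ⟨η, h0, h1, hlt⟩ :=
      exists_sub_smul_mem_forwardCone hp.1 (v := b - p) hcon (b - a)
    have hx : c + (1 / 2 : ℝ) • (p - c) ∈ doubleConeSet c e :=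
      doubleConeSet_subset (by simp) hp.2.le
        (smul_vertices_mem hp.1 (by norm_num) (by norm_num))
    have hs := h hx _ (hO ▸ smul_vertices_mem hab (sub_pos.2 h1) (sub_lt_self 1 h0))
    have hxy : (1 / 2 : ℝ) • (p - c) + (b - p) - η • (b - a) =
        a + (1 - η) • (b - a) - (c + (1 / 2 : ℝ) • (p - c)) := by
      match_scalars <;> norm_num
    rw [hxy] at hlt
    rw [abs_sub_comm, norm_sub_rev] at hs
    exact absurd (hs.trans hlt) (not_lt.2 (le_abs_self _))

theorem exists_subset_of_mem_spacelikeRegion {a b p : Minkowski d} {O : DoubleCone d}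
    (hO : O.1 = doubleConeSet a b) (hp : p ∈ spacelikeRegion a b) :
    ∃ δ > 0, ∀ ε > 0, ε ≤ δ → ∃ O₂ : DoubleCone d,
      O₂.1 = doubleConeSet (p - (ε, 0)) (p + (ε, 0)) ∧ p ∈ O₂.1 ∧ O₂.Spacelike O := by
  obtain ⟨h1, h2⟩ := hp
  refine ⟨min (‖p.2 - a.2‖ - (p.1 - a.1)) (‖p.2 - b.2‖ - (b.1 - p.1)),
    lt_min (sub_pos.2 h1) (sub_pos.2 h2), fun ε hε hle => ?_⟩
  refine ⟨⟨_, p - (ε, 0), p + (ε, 0), ?_, rfl⟩, rfl, ?_, ?_⟩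
  · show ‖_‖ < _
    simp
    linarith
  · show _ ∈ doubleConeSet _ _
    rw [mem_doubleConeSet]
    simp [hε]
  · have e1 := hle.trans (min_le_left _ _)
    have e2 := hle.trans (min_le_right _ _)
    refine spacelike_of_vertices hO rfl ?_ ?_
    · simp
      linarith
    · simp
      linarith

/-- Every point of the spacelike region has a neighborhood basis of double cones spacelike
to the given one. -/
theorem exists_le_of_mem_spacelikeRegion {a b p : Minkowski d} {O O₁ O₂ : DoubleCone d}
    (hO : O.1 = doubleConeSet a b) (hp : p ∈ spacelikeRegion a b) (hp₁ : p ∈ O₁.1)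
    (hp₂ : p ∈ O₂.1) :
    ∃ O₃ : DoubleCone d, p ∈ O₃.1 ∧ O₃.Spacelike O ∧ O₃ ≤ O₁ ∧ O₃ ≤ O₂ := by
  obtain ⟨δ, hδ, H⟩ := exists_subset_of_mem_spacelikeRegion hO hp
  have small : ∀ O' : DoubleCone d, p ∈ O'.1 → ∃ δ' > 0, ∀ ε ≤ δ',
      doubleConeSet (p - (ε, 0)) (p + (ε, 0)) ⊆ O'.1 := by
    rintro ⟨_, c, e, hce, rfl⟩ ⟨h1, h2⟩
    have h1' : ‖p.2 - c.2‖ < p.1 - c.1 := h1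
    have h2' : ‖e.2 - p.2‖ < e.1 - p.1 := h2
    refine ⟨min (p.1 - c.1 - ‖p.2 - c.2‖) (e.1 - p.1 - ‖e.2 - p.2‖),
      lt_min (sub_pos.2 h1') (sub_pos.2 h2'), fun ε hle => ?_⟩
    have e1 := hle.trans (min_le_left _ _)
    have e2 := hle.trans (min_le_right _ _)
    refine doubleConeSet_subset ?_ ?_
    · simp
      linarith
    · simp
      linarith
  obtain ⟨δ₁, hδ₁, H₁⟩ := small O₁ hp₁
  obtain ⟨δ₂, hδ₂, H₂⟩ := small O₂ hp₂
  obtain ⟨O₃, hO₃, hp₃, hs⟩ := H (min δ (min δ₁ δ₂)) (lt_min hδ (lt_min hδ₁ hδ₂)) (min_le_left _ _)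
  refine ⟨O₃, hp₃, hs, ?_, ?_⟩
  · show O₃.1 ⊆ O₁.1
    rw [hO₃]
    exact H₁ _ ((min_le_right _ _).trans (min_le_left _ _))
  · show O₃.1 ⊆ O₂.1
    rw [hO₃]
    exact H₂ _ ((min_le_right _ _).trans (min_le_right _ _))

theorem exists_spacelike (hd : 1 ≤ d) (O : DoubleCone d) : ∃ O₁ : DoubleCone d, O₁.Spacelike O := by
  obtain ⟨a, b, -, hO⟩ := O.2
  obtain ⟨p, hp⟩ := spacelikeRegion_nonempty hd a b
  obtain ⟨δ, hδ, H⟩ := exists_subset_of_mem_spacelikeRegion hO hp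
  obtain ⟨O₁, -, -, h⟩ := H δ hδ le_rfl
  exact ⟨O₁, h⟩

/-- In at least two space dimensions, the double cones spacelike to a given one are connected
by inclusions. -/
theorem eq_of_spacelike {α : Type*} (hd : 2 ≤ d) (O : DoubleCone d) (φ : DoubleCone d → α)
    (hφ : ∀ O₁ O₂ : DoubleCone d, O₁ ≤ O₂ → O₂.Spacelike O → φ O₁ = φ O₂)
    {O₁ O₂ : DoubleCone d} (h₁ : O₁.Spacelike O) (h₂ : O₂.Spacelike O) : φ O₁ = φ O₂ := by
  obtain ⟨a, b, hab, hO⟩ := O.2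
  have overlap : ∀ p ∈ spacelikeRegion a b, ∀ O₁ O₂ : DoubleCone d, O₁.Spacelike O →
      O₂.Spacelike O → p ∈ O₁.1 → p ∈ O₂.1 → φ O₁ = φ O₂ := by
    intro p hp O₁ O₂ h₁ h₂ hp₁ hp₂
    obtain ⟨O₃, -, -, h31, h32⟩ := exists_le_of_mem_spacelikeRegion hO hp hp₁ hp₂
    exact (hφ _ _ h31 h₁).symm.trans (hφ _ _ h32 h₂)
  have exists_mem : ∀ p ∈ spacelikeRegion a b, ∃ O' : DoubleCone d, p ∈ O'.1 ∧ O'.Spacelike O := by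
    intro p hp
    obtain ⟨δ, hδ, H⟩ := exists_subset_of_mem_spacelikeRegion hO hp
    obtain ⟨O', -, h⟩ := H δ hδ le_rfl
    exact ⟨O', h⟩
  obtain ⟨p, hp⟩ := O₁.nonempty
  obtain ⟨q, hq⟩ := O₂.nonempty
  -- Points are related if all spacelike cones around them carry the same value of `φ`. Overlapping
  -- cones contain a common smaller one, so nearby points are related, and preconnectedness does the
  -- rest.
  refine (isPreconnected_spacelikeRegion hd hab).induction₂
    (fun p q => ∀ O₁ O₂ : DoubleCone d, O₁.Spacelike O → O₂.Spacelike O → p ∈ O₁.1 → q ∈ O₂.1 →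
      φ O₁ = φ O₂) ?_ ?_ ?_ (h₁.subset_spacelikeRegion hab hO hp)
    (h₂.subset_spacelikeRegion hab hO hq) O₁ O₂ h₁ h₂ hp hq
  · intro p hp
    obtain ⟨O', hpO', hO'⟩ := exists_mem p hp
    have hopen : IsOpen O'.1 := by
      obtain ⟨_, c, e, -, rfl⟩ := O'
      exact isOpen_doubleConeSet c e
    filter_upwards [nhdsWithin_le_nhds (hopen.mem_nhds hpO'), self_mem_nhdsWithin]
      with q hq hqs O₁ O₂ h₁ h₂ hp₁ hq₂
    exact (overlap p hp O₁ O' h₁ hO' hp₁ hpO').trans (overlap q hqs O' O₂ hO' h₂ hq hq₂)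
  · intro x y z _ hy _ hxy hyz O₁ O₂ h₁ h₂ hx₁ hz₂
    obtain ⟨O', hyO', hO'⟩ := exists_mem y hy
    exact (hxy O₁ O' h₁ hO' hx₁ hyO').trans (hyz O' O₂ hO' h₂ hyO' hz₂)
  · intro x y _ _ hxy O₁ O₂ h₁ h₂ hy hx
    exact (hxy O₂ O₁ h₂ h₁ hx hy).symm

end DoubleCone
end

noncomputable section

/-! ### Extending operators from `E H` to the commutant. -/

section Extension

variable {H : Type*} [NormedAddCommGroup H] [InnerProductSpace ℂ H]

theorem ContinuousLinearMap.eq_of_eqOn_dense_span {G : Type*} [NormedAddCommGroup G]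
    [NormedSpace ℂ G] {s : Set H} (hs : (Submodule.span ℂ s).topologicalClosure = ⊤)
    {T T' : H →L[ℂ] G} (h : ∀ y ∈ s, T y = T' y) : T = T' :=
  ContinuousLinearMap.ext_on (Submodule.dense_iff_topologicalClosure_eq_top.2 hs) h

/-- The linear map sending `∑ᵢ δ(Aᵢ, xᵢ)` to `∑ᵢ Aᵢ Y xᵢ`. -/
def dilationMap (S : Set (H →L[ℂ] H)) (Y : H →L[ℂ] H) : (S →₀ H) →ₗ[ℂ] H :=
  Finsupp.lsum ℂ fun A : S => ((A.1 * Y : H →L[ℂ] H) : H →ₗ[ℂ] H)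

theorem dilationMap_apply (S : Set (H →L[ℂ] H)) (Y : H →L[ℂ] H) (f : S →₀ H) :
    dilationMap S Y f = f.sum fun A x => A.1 (Y x) :=
  rfl

theorem dilationMap_single (S : Set (H →L[ℂ] H)) (Y : H →L[ℂ] H) (A : S) (x : H) :
    dilationMap S Y (Finsupp.single A x) = A.1 (Y x) := by
  simp [dilationMap]

theorem dilationMap_sub (S : Set (H →L[ℂ] H)) (Y Z : H →L[ℂ] H) (f : S →₀ H) :
    dilationMap S (Y - Z) f = dilationMap S Y f - dilationMap S Z f := by
  simp [dilationMap_apply, Finsupp.sum]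

theorem dilationMap_smul (S : Set (H →L[ℂ] H)) (c : ℂ) (Y : H →L[ℂ] H) (f : S →₀ H) :
    dilationMap S (c • Y) f = c • dilationMap S Y f := by
  simp [dilationMap_apply, Finsupp.sum, Finset.smul_sum]

theorem denseRange_dilationMap {S : Set (H →L[ℂ] H)} {E : H →L[ℂ] H}
    (hS : (Submodule.span ℂ {y : H | ∃ A ∈ S, ∃ x : H, y = A (E x)}).topologicalClosure = ⊤) :
    DenseRange (dilationMap S E) := by
  refine (Submodule.dense_iff_topologicalClosure_eq_top.2 hS).mono ?_
  rw [← LinearMap.coe_range, SetLike.coe_subset_coe, Submodule.span_le]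
  rintro _ ⟨A, hA, x, rfl⟩
  exact ⟨Finsupp.single ⟨A, hA⟩ x, dilationMap_single S E ⟨A, hA⟩ x⟩

variable [CompleteSpace H]

theorem inner_dilationMap {S : Set (H →L[ℂ] H)} {Y Z Y' Z' : H →L[ℂ] H} (f : S →₀ H)
    (h : ∀ A ∈ S, ∀ B ∈ S, star (A * Y) * (B * Z) = star (A * Y') * (B * Z')) :
    inner ℂ (dilationMap S Y f) (dilationMap S Z f) =
      inner ℂ (dilationMap S Y' f) (dilationMap S Z' f) := by
  simp only [dilationMap_apply, Finsupp.sum_inner, Finsupp.inner_sum]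
  refine Finset.sum_congr rfl fun B _ => Finset.sum_congr rfl fun A _ => ?_
  have h1 := congrArg (fun T : H →L[ℂ] H => inner ℂ (f A) (T (f B))) (h A.1 A.2 B.1 B.2)
  simpa [ContinuousLinearMap.star_eq_adjoint, ContinuousLinearMap.adjoint_inner_right] using h1

/-- In `Y* A* B Y` the factor `Y*` moves to the right past `E A* B E`, with which it commutes. -/
theorem inner_dilationMap_self {S : Set (H →L[ℂ] H)} {E Y : H →L[ℂ] H}
    (hmul : ∀ A ∈ S, ∀ B ∈ S, A * B ∈ S) (hstar : ∀ A ∈ S, star A ∈ S) (hE : IsStarProjection E)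
    (hEY : E * Y = Y) (hYE : Y * E = Y) (hY : ∀ A ∈ S, Commute Y (E * A * E)) (f : S →₀ H) :
    inner ℂ (dilationMap S Y f) (dilationMap S Y f) =
      inner ℂ (dilationMap S E f) (dilationMap S (star Y * Y) f) := by
  have hE1 : star E = E := hE.isSelfAdjoint
  refine inner_dilationMap f fun A hA B hB => ?_
  have hsE : star Y * E = star Y := by rw [← hE1, ← star_mul, hEY]
  have hEs : E * star Y = star Y := by rw [← hE1, ← star_mul, hYE]
  have hc : star Y * (E * (star A * B) * E) = E * (star A * B) * E * star Y := by
    have := congrArg star (hY _ (hmul _ (hstar _ hB) _ hA)).eq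
    simp only [star_mul, star_star, hE1] at this
    simp only [mul_assoc] at this ⊢
    exact this.symm
  calc star (A * Y) * (B * Y) = star Y * (star A * B) * Y := by
        rw [star_mul]; simp only [mul_assoc]
    _ = (star Y * E) * (star A * B) * (E * Y) := by rw [hsE, hEY]
    _ = (star Y * (E * (star A * B) * E)) * Y := by simp only [mul_assoc]
    _ = E * (star A * B) * (E * star Y) * Y := by rw [hc]; simp only [mul_assoc]
    _ = star (A * E) * (B * (star Y * Y)) := by
        rw [hEs, star_mul, hE1]; simp only [mul_assoc]

/-- Let `D` be the square root of `‖X‖² - X* X`. It inherits commutation with `E S E`, so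
`inner_dilationMap_self` applies to `X` and to `E * D`. Together they show that `‖X‖² ‖∑ A E x‖² -
‖∑ A X x‖²` equals `‖∑ A E D x‖²`, which is nonnegative. -/
theorem norm_dilationMap_le {S : Set (H →L[ℂ] H)} {E X : H →L[ℂ] H}
    (hmul : ∀ A ∈ S, ∀ B ∈ S, A * B ∈ S) (hstar : ∀ A ∈ S, star A ∈ S) (hE : IsStarProjection E)
    (hEX : E * X = X) (hXE : X * E = X) (hX : ∀ A ∈ S, Commute X (E * A * E)) (f : S →₀ H) :
    ‖dilationMap S X f‖ ≤ ‖X‖ * ‖dilationMap S E f‖ := by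
  have hE1 : star E = E := hE.isSelfAdjoint
  have hE2 : E * E = E := hE.isIdempotentElem
  have hsE : star X * E = star X := by rw [← hE1, ← star_mul, hEX]
  have hEs : E * star X = star X := by rw [← hE1, ← star_mul, hXE]
  set Q : H →L[ℂ] H := algebraMap ℝ (H →L[ℂ] H) (‖X‖ ^ 2) - star X * X with hQ
  have hQ0 : 0 ≤ Q := sub_nonneg.2 CStarAlgebra.star_mul_le_algebraMap_norm_sq
  set D := CFC.sqrt Q with hD
  have hDD : D * D = Q := CFC.sqrt_mul_sqrt_self Q hQ0
  have hDs : star D = D := (CFC.sqrt_nonneg Q).isSelfAdjoint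
  have hDcomm : ∀ Z : H →L[ℂ] H, Commute (star X * X) Z → Commute D Z := by
    intro Z hZ
    have h1 : Commute Q Z := (Algebra.commute_algebraMap_left (‖X‖ ^ 2) Z).sub_left hZ
    exact h1.cfcₙ_nnreal _
  have hXs : ∀ A ∈ S, Commute (star X) (E * A * E) := by
    intro A hA
    have := (hX _ (hstar _ hA)).star_star
    simpa [hE1, mul_assoc] using this
  have hDE : Commute D E := hDcomm E (by
    show star X * X * E = E * (star X * X)
    rw [mul_assoc, hXE, ← mul_assoc, hEs])
  have hDA : ∀ A ∈ S, Commute D (E * A * E) := fun A hA =>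
    hDcomm _ ((hXs A hA).mul_left (hX A hA))
  have hsq : star (E * D) * (E * D) = ((‖X‖ ^ 2 : ℝ) : ℂ) • E - star X * X := by
    rw [star_mul, hDs, hE1]
    calc D * E * (E * D) = D * (E * E) * D := by simp only [mul_assoc]
      _ = E * (D * D) := by rw [hE2, hDE.eq, mul_assoc]
      _ = _ := by
        rw [hDD, hQ, mul_sub, ← mul_assoc, hEs, Algebra.algebraMap_eq_smul_one, mul_smul_comm,
          mul_one, ← Complex.coe_smul]
  have h1 := inner_dilationMap_self hmul hstar hE hEX hXE hX f
  have h2 := inner_dilationMap_self (Y := E * D) hmul hstar hE (by rw [← mul_assoc, hE2])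
    (by rw [mul_assoc, hDE.eq, ← mul_assoc, hE2])
    (fun A hA => ((show Commute E (E * A * E) by
      show E * (E * A * E) = E * A * E * E
      rw [mul_assoc _ E E, hE2, mul_assoc E A, ← mul_assoc E E, hE2])).mul_left (hDA A hA)) f
  rw [hsq, dilationMap_sub, inner_sub_right, ← h1, dilationMap_smul, inner_smul_right,
    inner_self_eq_norm_sq_to_K, inner_self_eq_norm_sq_to_K, inner_self_eq_norm_sq_to_K] at h2
  have h3 : ‖dilationMap S (E * D) f‖ ^ 2 =
      ‖X‖ ^ 2 * ‖dilationMap S E f‖ ^ 2 - ‖dilationMap S X f‖ ^ 2 := by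
    apply Complex.ofReal_injective
    push_cast at h2 ⊢
    exact h2
  refine le_of_sq_le_sq ?_ (by positivity)
  rw [mul_pow]
  nlinarith [sq_nonneg ‖dilationMap S (E * D) f‖]

/-- If `E` is cyclic for a `*`-closed multiplicative set `S` of operators, then an operator on
`E H` commuting with `E S E` extends to an operator on `H` commuting with `S`. -/
theorem exists_extension_mem_centralizer {S : Set (H →L[ℂ] H)} {E X : H →L[ℂ] H}
    (hone : 1 ∈ S) (hmul : ∀ A ∈ S, ∀ B ∈ S, A * B ∈ S) (hstar : ∀ A ∈ S, star A ∈ S)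
    (hE : IsStarProjection E)
    (hS : (Submodule.span ℂ {y : H | ∃ A ∈ S, ∃ x : H, y = A (E x)}).topologicalClosure = ⊤)
    (hEX : E * X = X) (hXE : X * E = X) (hX : ∀ A ∈ S, Commute X (E * A * E)) :
    ∃ T ∈ S.centralizer, T * E = X ∧ E * T = X := by
  have hE2 : E * E = E := hE.isIdempotentElem
  -- The continuous extension of `∑ A E x ↦ ∑ A X x`; the norm bound also makes this rule well
  -- defined.
  set T := (dilationMap S X).extendOfNorm (dilationMap S E)
  have hT : ∀ A ∈ S, T * A * E = A * X := by
    intro A hA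
    ext x
    have := LinearMap.extendOfNorm_eq (f := dilationMap S X) (denseRange_dilationMap hS)
      ⟨‖X‖, norm_dilationMap_le hmul hstar hE hEX hXE hX⟩ (Finsupp.single ⟨A, hA⟩ x)
    rwa [dilationMap_single, dilationMap_single] at this
  have hTE : T * E = X := by simpa using hT 1 hone
  refine ⟨T, fun A hA => ?_, hTE, ?_⟩
  · refine ContinuousLinearMap.eq_of_eqOn_dense_span hS ?_
    rintro _ ⟨B, hB, x, rfl⟩
    have h : A * T * B * E = T * A * B * E := by
      rw [mul_assoc T A B, hT _ (hmul _ hA _ hB), mul_assoc A T B, mul_assoc A, hT _ hB, mul_assoc]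
    exact congrArg (fun T : H →L[ℂ] H => T x) h
  · refine ContinuousLinearMap.eq_of_eqOn_dense_span hS ?_
    rintro _ ⟨B, hB, x, rfl⟩
    have h : E * T * B * E = X * B * E := by
      calc E * T * B * E = E * (T * B * E) := by simp only [mul_assoc]
        _ = E * B * (E * X) := by rw [hT B hB, hEX, mul_assoc]
        _ = E * B * E * X := by simp only [mul_assoc]
        _ = X * (E * B * E) := (hX B hB).eq.symm
        _ = X * E * B * E := by simp only [mul_assoc]
        _ = X * B * E := by rw [hXE]
    exact congrArg (fun T : H →L[ℂ] H => T x) h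

end Extension
end

noncomputable section

/-! ### Gradings and twisted commutation. -/

section Twist

variable {H H' : Type*} [NormedAddCommGroup H] [InnerProductSpace ℂ H]
  [NormedAddCommGroup H'] [InnerProductSpace ℂ H']

theorem mul_evenPart_mul {k : H →L[ℂ] H} (hk : k * k = 1) (A : H →L[ℂ] H) :
    k * ((1 / 2 : ℂ) • (A + k * A * k)) * k = (1 / 2 : ℂ) • (A + k * A * k) := by
  have h : k * (k * A * k) * k = A := by
    calc k * (k * A * k) * k = (k * k) * A * (k * k) := by simp only [mul_assoc]
      _ = A := by rw [hk, one_mul, mul_one]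
  rw [mul_smul_comm, smul_mul_assoc, mul_add, add_mul, h, add_comm]

theorem mul_oddPart_mul {k : H →L[ℂ] H} (hk : k * k = 1) (A : H →L[ℂ] H) :
    k * ((1 / 2 : ℂ) • (A - k * A * k)) * k = -((1 / 2 : ℂ) • (A - k * A * k)) := by
  have h : k * (k * A * k) * k = A := by
    calc k * (k * A * k) * k = (k * k) * A * (k * k) := by simp only [mul_assoc]
      _ = A := by rw [hk, one_mul, mul_one]
  rw [mul_smul_comm, smul_mul_assoc, mul_sub, sub_mul, h, ← smul_neg, neg_sub]

theorem evenPart_add_oddPart (k A : H →L[ℂ] H) :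
    (1 / 2 : ℂ) • (A + k * A * k) + (1 / 2 : ℂ) • (A - k * A * k) = A := by
  match_scalars <;> norm_num

theorem mul_of_even {k A : H →L[ℂ] H} (hk : k * k = 1) (hA : k * A * k = A) : k * A = A * k := by
  calc k * A = k * A * (k * k) := by rw [hk, mul_one]
    _ = k * A * k * k := by simp only [mul_assoc]
    _ = A * k := by rw [hA]

theorem mul_of_odd {k A : H →L[ℂ] H} (hk : k * k = 1) (hA : k * A * k = -A) :
    k * A = -(A * k) := by
  calc k * A = k * A * (k * k) := by rw [hk, mul_one]
    _ = k * A * k * k := by simp only [mul_assoc]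
    _ = -(A * k) := by rw [hA, neg_mul]

/-- A set of operators that contains the even and odd parts of its elements. -/
structure IsGraded (k : H →L[ℂ] H) (S : Set (H →L[ℂ] H)) : Prop where
  zero_mem : 0 ∈ S
  even_mem : ∀ A ∈ S, (1 / 2 : ℂ) • (A + k * A * k) ∈ S
  odd_mem : ∀ A ∈ S, (1 / 2 : ℂ) • (A - k * A * k) ∈ S

/-- A preimage of an even or odd element need not be homogeneous, but its even or odd part is
another preimage. -/
theorem twist_image {k : H →L[ℂ] H} {k' : H' →L[ℂ] H'} (hk : k * k = 1)
    {S : Set (H →L[ℂ] H)} (hS : IsGraded k S) (φ : (H →L[ℂ] H) →ₗ[ℂ] (H' →L[ℂ] H'))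
    (hφ : ∀ A, φ (k * A) = k' * φ A) (hφ' : ∀ A, φ (A * k) = φ A * k') :
    twist k' (φ '' S) = φ '' twist k S := by
  have hconj : ∀ A, φ (k * A * k) = k' * φ A * k' := fun A => by rw [hφ', hφ]
  ext X
  constructor
  · rintro ⟨_, ⟨A, hA, rfl⟩, _, ⟨B, hB, rfl⟩, h1, h2, rfl⟩
    refine ⟨_, ⟨_, hS.even_mem A hA, _, hS.odd_mem B hB, mul_evenPart_mul hk A,
      mul_oddPart_mul hk B, rfl⟩, ?_⟩
    rw [map_add, map_smul, map_smul, hφ, map_smul, map_add, map_sub, hconj, hconj, h1, h2,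
      sub_neg_eq_add, ← two_smul ℂ, ← two_smul ℂ, smul_smul, smul_smul]
    norm_num
  · rintro ⟨_, ⟨A, hA, B, hB, h1, h2, rfl⟩, rfl⟩
    refine ⟨_, ⟨A, hA, rfl⟩, _, ⟨B, hB, rfl⟩, ?_, ?_, ?_⟩
    · rw [← hconj, h1]
    · rw [← hconj, h2, map_neg]
    · rw [map_add, map_smul, hφ]

/-- Twisted commutation is symmetric. -/
theorem commute_twist_symm {k : H →L[ℂ] H} (hk : k * k = 1) {S T : Set (H →L[ℂ] H)}
    (hT : IsGraded k T) (h : ∀ A ∈ S, ∀ Y ∈ twist k T, Commute A Y) :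
    ∀ B ∈ T, ∀ X ∈ twist k S, Commute B X := by
  rintro B hB _ ⟨A₀, hA₀, A₁, hA₁, hk₀, hk₁, rfl⟩
  rw [← evenPart_add_oddPart k B]
  have hB₀ := hT.even_mem B hB
  have hB₁ := hT.odd_mem B hB
  have hkB₀ := mul_evenPart_mul hk B
  have hkB₁ := mul_oddPart_mul hk B
  generalize (1 / 2 : ℂ) • (B + k * B * k) = B₀ at *
  generalize (1 / 2 : ℂ) • (B - k * B * k) = B₁ at *
  have even : ∀ A ∈ S, Commute A B₀ := fun A hA =>
    h A hA B₀ ⟨B₀, hB₀, 0, hT.zero_mem, hkB₀, by simp, by simp⟩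
  have odd : ∀ A ∈ S, Commute A (k * B₁) := fun A hA => by
    have h1 := h A hA (0 + Complex.I • (k * B₁))
      ⟨0, hT.zero_mem, B₁, hB₁, by simp, hkB₁, rfl⟩
    rw [zero_add] at h1
    have h2 := h1.smul_right (-Complex.I)
    rwa [smul_smul, neg_mul, Complex.I_mul_I, neg_neg, one_smul] at h2
  have k0 := mul_of_even hk hk₀
  have k1 := mul_of_odd hk hk₁
  have kB0 := mul_of_even hk hkB₀
  have kB1 := mul_of_odd hk hkB₁
  have cancel : ∀ {U V : H →L[ℂ] H}, k * U = k * V → U = V := fun {U V} huv => by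
    rw [← one_mul U, ← one_mul V, ← hk, mul_assoc, huv, mul_assoc]
  have c00 : Commute B₀ A₀ := (even A₀ hA₀).symm
  have c01 : Commute B₀ (k * A₁) := (show Commute B₀ k from kB0.symm).mul_right (even A₁ hA₁).symm
  have c10 : Commute B₁ A₀ := by
    refine cancel ?_
    rw [← mul_assoc, ← (odd A₀ hA₀).eq, ← mul_assoc, ← k0, mul_assoc]
  -- Moving `k` past `B₁` and past `A₁` gives two signs, which cancel.
  have c11 : Commute B₁ (k * A₁) := by
    have h1 : A₁ * (k * B₁) = k * B₁ * A₁ := (odd A₁ hA₁).eq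
    show B₁ * (k * A₁) = k * A₁ * B₁
    calc B₁ * (k * A₁) = (B₁ * k) * A₁ := by rw [mul_assoc]
      _ = -(k * B₁ * A₁) := by rw [kB1, neg_mul, neg_neg]
      _ = -(A₁ * k) * B₁ := by rw [← h1, neg_mul, mul_assoc]
      _ = k * A₁ * B₁ := by rw [k1]
  exact ((c00.add_right (c01.smul_right _)).add_left (c10.add_right (c11.smul_right _)))

end Twist

/-! ### Extension to the dual net. -/

namespace GradedNet

variable {d : ℕ} {H : Type*} [NormedAddCommGroup H] [InnerProductSpace ℂ H] [CompleteSpace H]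

theorem isGraded (F : GradedNet d H) (O : DoubleCone d) : IsGraded F.k (F.sets O) where
  zero_mem := (F.algebra O).toStarSubalgebra.zero_mem
  even_mem A hA := (F.algebra O).toStarSubalgebra.smul_mem
    ((F.algebra O).toStarSubalgebra.add_mem hA (F.k_conj_mem O A hA)) _
  odd_mem A hA := (F.algebra O).toStarSubalgebra.smul_mem
    ((F.algebra O).toStarSubalgebra.sub_mem hA (F.k_conj_mem O A hA)) _

theorem one_mem_twist (F : GradedNet d H) (O : DoubleCone d) : 1 ∈ twist F.k (F.sets O) :=
  ⟨1, (F.algebra O).toStarSubalgebra.one_mem, 0, (F.isGraded O).zero_mem,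
    by rw [mul_one, F.k_mul_k], by simp, by simp⟩

/-- For odd `B` and `B'`, the sign in `k B k B' = -B B'` is cancelled by the square of `i`. -/
theorem mul_mem_twist (F : GradedNet d H) (O : DoubleCone d) {X Y : H →L[ℂ] H}
    (hX : X ∈ twist F.k (F.sets O)) (hY : Y ∈ twist F.k (F.sets O)) :
    X * Y ∈ twist F.k (F.sets O) := by
  obtain ⟨A, hA, B, hB, hkA, hkB, rfl⟩ := hX
  obtain ⟨A', hA', B', hB', hkA', hkB', rfl⟩ := hY
  have hkk := F.k_mul_k
  have mul : ∀ {U V}, U ∈ F.sets O → V ∈ F.sets O → U * V ∈ F.sets O :=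
    fun hU hV => (F.algebra O).toStarSubalgebra.mul_mem hU hV
  have add : ∀ {U V}, U ∈ F.sets O → V ∈ F.sets O → U + V ∈ F.sets O :=
    fun hU hV => (F.algebra O).toStarSubalgebra.add_mem hU hV
  have conj : ∀ U V : H →L[ℂ] H, F.k * (U * V) * F.k = (F.k * U * F.k) * (F.k * V * F.k) := by
    intro U V
    calc F.k * (U * V) * F.k = F.k * U * 1 * V * F.k := by simp only [mul_assoc, one_mul]
      _ = _ := by rw [← hkk]; simp only [mul_assoc]
  refine ⟨A * A' + B * B', add (mul hA hA') (mul hB hB'), A * B' + B * A',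
    add (mul hA hB') (mul hB hA'), ?_, ?_, ?_⟩
  · rw [mul_add, add_mul, conj, conj, hkA, hkA', hkB, hkB', neg_mul_neg]
  · rw [mul_add, add_mul, conj, conj, hkA, hkA', hkB, hkB']
    noncomm_ring
  · have h1 : A * (F.k * B') = F.k * (A * B') := by
      rw [← mul_assoc, ← mul_of_even hkk hkA, mul_assoc]
    have h2 : F.k * B * (F.k * B') = -(B * B') := by
      rw [← mul_assoc, hkB, neg_mul]
    rw [add_mul, mul_add, mul_add, mul_smul_comm, smul_mul_smul_comm, smul_mul_assoc, h1, h2,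
      Complex.I_mul_I, mul_assoc, mul_add, smul_add, neg_smul, one_smul, neg_neg]
    abel

theorem twist_mono (F : GradedNet d H) {O₁ O₂ : DoubleCone d} (h : O₁ ≤ O₂) :
    twist F.k (F.sets O₁) ⊆ twist F.k (F.sets O₂) := by
  rintro _ ⟨A, hA, B, hB, h'⟩
  exact ⟨A, F.isotony _ _ h hA, B, F.isotony _ _ h hB, h'⟩

theorem mem_dual_iff (F : GradedNet d H) {O : DoubleCone d} {X : H →L[ℂ] H} :
    X ∈ F.dual.algebra O ↔ ∀ O₁ : DoubleCone d, O₁.Spacelike O →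
      X ∈ (twist F.k (F.sets O₁)).centralizer := by
  change X ∈ twistedDual F.k F.sets O ↔ _
  simp only [twistedDual, Set.mem_iInter]

variable {E : H →L[ℂ] H}

/-- A projection commuting with `k` that is cyclic for a net is cyclic for its twist. -/
theorem isCyclicFor_twist {F : GradedNet d H} (hEk : Commute E F.k) (hcyc : IsCyclicFor E F.sets) :
    IsCyclicFor E fun O => twist F.k (F.sets O) := by
  intro O
  rw [eq_top_iff, ← hcyc O]
  refine Submodule.topologicalClosure_mono (Submodule.span_le.2 ?_)
  rintro _ ⟨A, hA, x, rfl⟩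
  have hA₀ := (F.isGraded O).even_mem A hA
  have hA₁ := (F.isGraded O).odd_mem A hA
  have hk₀ := mul_evenPart_mul F.k_mul_k A
  have hk₁ := mul_oddPart_mul F.k_mul_k A
  rw [← evenPart_add_oddPart F.k A]
  generalize (1 / 2 : ℂ) • (A + F.k * A * F.k) = A₀ at *
  generalize (1 / 2 : ℂ) • (A - F.k * A * F.k) = A₁ at *
  refine Submodule.add_mem _ ?_ ?_
  · exact Submodule.subset_span
      ⟨A₀, ⟨A₀, hA₀, 0, (F.isGraded O).zero_mem, hk₀, by simp, by simp⟩, x, rfl⟩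
  -- As `k` commutes with `E`, it can be absorbed into the vector `x`.
  · have h : A₁ * E = Complex.I • ((0 + Complex.I • (F.k * A₁)) * E * F.k) := by
      rw [zero_add, mul_assoc, hEk.eq, smul_mul_assoc, smul_smul, Complex.I_mul_I, neg_one_smul,
        ← mul_assoc, hk₁, neg_mul, neg_neg]
    have h' : A₁ (E x) = Complex.I • ((0 + Complex.I • (F.k * A₁)) (E (F.k x))) :=
      congrArg (fun T : H →L[ℂ] H => T x) h
    change A₁ (E x) ∈ _
    rw [h']
    exact Submodule.smul_mem _ _ (Submodule.subset_span
      ⟨_, ⟨0, (F.isGraded O).zero_mem, A₁, hA₁, by simp, hk₁, rfl⟩, F.k x, rfl⟩)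

/-- On the total set of vectors `A E x`, such a `T` acts as `A T E x`. -/
theorem eq_of_mem_centralizer_twist {F : GradedNet d H} (hEk : Commute E F.k)
    (hcyc : IsCyclicFor E F.sets) {O : DoubleCone d} {T T' : H →L[ℂ] H}
    (hT : T ∈ (twist F.k (F.sets O)).centralizer) (hT' : T' ∈ (twist F.k (F.sets O)).centralizer)
    (h : T * E = T' * E) : T = T' := by
  refine ContinuousLinearMap.eq_of_eqOn_dense_span (isCyclicFor_twist hEk hcyc O) ?_
  rintro _ ⟨A, hA, x, rfl⟩
  have h1 : T * A * E = T' * A * E := by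
    rw [← hT A hA, ← hT' A hA, mul_assoc, h, mul_assoc]
  exact congrArg (fun T : H →L[ℂ] H => T x) h1

/-- If `E` is cyclic for a net, then it is separating for the dual net. -/
theorem eq_of_mem_dual {F : GradedNet d H} (hd : 1 ≤ d) (hEk : Commute E F.k)
    (hcyc : IsCyclicFor E F.sets) {O : DoubleCone d} {T T' : H →L[ℂ] H}
    (hT : T ∈ F.dual.algebra O) (hT' : T' ∈ F.dual.algebra O) (h : T * E = T' * E) : T = T' := by
  obtain ⟨O₁, hO₁⟩ := DoubleCone.exists_spacelike hd O
  exact eq_of_mem_centralizer_twist hEk hcyc (F.mem_dual_iff.1 hT O₁ hO₁)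
    (F.mem_dual_iff.1 hT' O₁ hO₁) h

/-- An operator on `E H` commuting with the compression of the twist of a net `F` over all
double cones spacelike to `O` extends to an element of `F^d(O)` commuting with `E`. -/
theorem exists_mem_dual_extension {F : GradedNet d H} (hd : 2 ≤ d) (hE : IsStarProjection E)
    (hEk : Commute E F.k) (hcyc : IsCyclicFor E F.sets) {O : DoubleCone d} {X : H →L[ℂ] H}
    (hEX : E * X = X) (hXE : X * E = X)
    (hX : ∀ O₁ : DoubleCone d, O₁.Spacelike O → ∀ Y ∈ twist F.k (F.sets O₁),
      Commute X (E * Y * E)) :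
    ∃ T ∈ F.dual.algebra O, T * E = X ∧ E * T = X := by
  -- The junk value `0` makes `φ` a function on all double cones, as `DoubleCone.eq_of_spacelike`
  -- requires.
  have ext : ∀ O₁ : DoubleCone d, ∃ T : H →L[ℂ] H, O₁.Spacelike O →
      T ∈ (twist F.k (F.sets O₁)).centralizer ∧ T * E = X ∧ E * T = X := by
    intro O₁
    by_cases h : O₁.Spacelike O
    · obtain ⟨T, hT⟩ := exists_extension_mem_centralizer (F.one_mem_twist O₁)
        (fun _ hA _ hB => F.mul_mem_twist O₁ hA hB) (fun _ hA => F.star_mem_twist O₁ hA) hE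
        (isCyclicFor_twist hEk hcyc O₁) hEX hXE (hX O₁ h)
      exact ⟨T, fun _ => hT⟩
    · exact ⟨0, fun h' => absurd h' h⟩
  choose φ hφ using ext
  obtain ⟨O₁, hO₁⟩ := DoubleCone.exists_spacelike (by omega) O
  refine ⟨φ O₁, F.mem_dual_iff.2 fun O₂ hO₂ => ?_, (hφ O₁ hO₁).2⟩
  have : φ O₁ = φ O₂ := by
    -- For `P ≤ Q`, `φ Q` also commutes with the smaller twisted algebra of `P` and agrees with `φ
    -- P` on `E H`.
    refine DoubleCone.eq_of_spacelike hd O φ (fun P Q hPQ hQ => ?_) hO₁ hO₂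
    have hP := hQ.mono_left hPQ
    exact eq_of_mem_centralizer_twist hEk hcyc (hφ P hP).1
      (Set.centralizer_subset (F.twist_mono hPQ) (hφ Q hQ).1)
      ((hφ P hP).2.1.trans (hφ Q hQ).2.1.symm)
  rw [this]
  exact (hφ O₂ hO₂).1

end GradedNet
end

noncomputable section

/-! ### Passing between operators on `E H` and corners on `H`. -/

section Compression

variable {H : Type*} [NormedAddCommGroup H] [InnerProductSpace ℂ H]

theorem IsGraded.image {k : H →L[ℂ] H} {S : Set (H →L[ℂ] H)} (hS : IsGraded k S)
    (φ : (H →L[ℂ] H) →ₗ[ℂ] (H →L[ℂ] H)) (hφ : ∀ A, φ (k * A * k) = k * φ A * k) :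
    IsGraded k (φ '' S) where
  zero_mem := ⟨0, hS.zero_mem, map_zero φ⟩
  even_mem := by
    rintro _ ⟨A, hA, rfl⟩
    exact ⟨_, hS.even_mem A hA, by rw [map_smul, map_add, hφ]⟩
  odd_mem := by
    rintro _ ⟨A, hA, rfl⟩
    exact ⟨_, hS.odd_mem A hA, by rw [map_smul, map_sub, hφ]⟩

/-- The map `A ↦ E A E` as a linear map. -/
def cornerMap (E : H →L[ℂ] H) : (H →L[ℂ] H) →ₗ[ℂ] (H →L[ℂ] H) where
  toFun A := E * A * E
  map_add' A B := by rw [mul_add, add_mul]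
  map_smul' c A := by rw [mul_smul_comm, smul_mul_assoc, RingHom.id_apply]

theorem cornerMap_apply (E A : H →L[ℂ] H) : cornerMap E A = E * A * E :=
  rfl

theorem cornerMap_mul_left {E k : H →L[ℂ] H} (hEk : Commute E k) (A : H →L[ℂ] H) :
    cornerMap E (k * A) = k * cornerMap E A := by
  rw [cornerMap_apply, cornerMap_apply, ← mul_assoc, hEk.eq]
  simp only [mul_assoc]

theorem cornerMap_mul_right {E k : H →L[ℂ] H} (hEk : Commute E k) (A : H →L[ℂ] H) :
    cornerMap E (A * k) = cornerMap E A * k := by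
  rw [cornerMap_apply, cornerMap_apply, mul_assoc _ E, hEk.eq]
  simp only [mul_assoc]

/-- `compress` as a linear map in its second argument. -/
def compressMap (E : H →L[ℂ] H) : (H →L[ℂ] H) →ₗ[ℂ] (E.range →L[ℂ] E.range) where
  toFun A := compress E A
  map_add' A B := by ext; simp [compress]
  map_smul' c A := by ext; simp [compress]

theorem compress_eq_compress_iff {E A B : H →L[ℂ] H} (hE : E * E = E) :
    compress E A = compress E B ↔ E * A * E = E * B * E := by
  constructor
  · intro h
    ext x
    have h1 : compress E A ⟨E x, x, rfl⟩ = compress E B ⟨E x, x, rfl⟩ := by rw [h]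
    simpa [compress] using congrArg Subtype.val h1
  · intro h
    ext x
    rw [coe_compress_apply E A hE, coe_compress_apply E B hE, h]

theorem compress_mul_compress {E : H →L[ℂ] H} (A B : H →L[ℂ] H) :
    compress E A * compress E B = compress E (A * E * B) :=
  rfl

/-- Extension by zero of an operator on the range of `E`, precomposed with `E`. -/
def extendRange (E : H →L[ℂ] H) (X : E.range →L[ℂ] E.range) : H →L[ℂ] H :=
  E.range.subtypeL ∘L X ∘L E.rangeRestrict

theorem mul_extendRange {E : H →L[ℂ] H} (hE : E * E = E) (X : E.range →L[ℂ] E.range) :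
    E * extendRange E X = extendRange E X := by
  ext x
  obtain ⟨y, hy⟩ := (X (E.rangeRestrict x)).2
  have h : E (E y) = E y := congrArg (fun T : H →L[ℂ] H => T y) hE
  show E (X (E.rangeRestrict x) : H) = (X (E.rangeRestrict x) : H)
  rw [← hy]
  exact h

theorem rangeRestrict_coe {E : H →L[ℂ] H} (hE : E * E = E) (x : E.range) :
    E.rangeRestrict (x : H) = x := by
  obtain ⟨_, y, rfl⟩ := x
  exact Subtype.ext (congrArg (fun T : H →L[ℂ] H => T y) hE)

theorem extendRange_mul {E : H →L[ℂ] H} (hE : E * E = E) (X : E.range →L[ℂ] E.range) :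
    extendRange E X * E = extendRange E X := by
  ext x
  have h := rangeRestrict_coe hE (E.rangeRestrict x)
  show (X (E.rangeRestrict (E x)) : H) = (X (E.rangeRestrict x) : H)
  exact congrArg (fun y => (X y : H)) h

theorem compress_extendRange {E : H →L[ℂ] H} (hE : E * E = E) (X : E.range →L[ℂ] E.range) :
    compress E (extendRange E X) = X := by
  ext x
  show (E.rangeRestrict (X (E.rangeRestrict x) : H) : H) = X x
  rw [rangeRestrict_coe hE, rangeRestrict_coe hE]

theorem commute_compress_iff {E : H →L[ℂ] H} (hE : E * E = E) (A B : H →L[ℂ] H) :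
    Commute (compress E A) (compress E B) ↔ Commute (E * A * E) (E * B * E) := by
  have h : ∀ A B : H →L[ℂ] H, E * (A * E * B) * E = E * A * E * (E * B * E) := by
    intro A B
    calc E * (A * E * B) * E = E * A * E * B * E := by simp only [mul_assoc]
      _ = E * A * (E * E) * B * E := by rw [hE]
      _ = _ := by simp only [mul_assoc]
  rw [commute_iff_eq, commute_iff_eq, compress_mul_compress, compress_mul_compress,
    compress_eq_compress_iff hE, h, h]

theorem compress_mul_left {E k : H →L[ℂ] H} (hE : E * E = E) (hEk : Commute E k)
    (A : H →L[ℂ] H) : compress E (k * A) = compress E k * compress E A := by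
  rw [compress_mul_compress, compress_eq_compress_iff hE, ← hEk.eq]
  simp only [← mul_assoc, hE]

theorem compress_mul_right {E k : H →L[ℂ] H} (hE : E * E = E) (hEk : Commute E k)
    (A : H →L[ℂ] H) : compress E (A * k) = compress E A * compress E k := by
  rw [compress_mul_compress, compress_eq_compress_iff hE, mul_assoc A E k, hEk.eq]
  simp only [mul_assoc, hE]

end Compression

section PositiveMaps

variable {H : Type*} [NormedAddCommGroup H] [InnerProductSpace ℂ H] [CompleteSpace H]

/-- Positivity suffices: for self-adjoint `Y` both `‖Y‖ • 1` and `‖Y‖ • 1 - Y` have self-adjoint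
images; the general case splits into real and imaginary parts. -/
theorem IsConditionalExpectation.map_star {M : VonNeumannAlgebra H}
    {m : M.toStarSubalgebra →ₗ[ℂ] M.toStarSubalgebra} (hm : IsConditionalExpectation M m)
    (X : M.toStarSubalgebra) : m (star X) = star (m X) := by
  have hpos : ∀ Y : M.toStarSubalgebra, (Y : H →L[ℂ] H).IsPositive → star (m Y) = m Y :=
    fun Y hY => Subtype.ext (hm.pos Y hY).isSelfAdjoint
  have hsa : ∀ Y : M.toStarSubalgebra, IsSelfAdjoint Y → star (m Y) = m Y := by
    intro Y hY
    have hY' : IsSelfAdjoint (Y : H →L[ℂ] H) := congrArg Subtype.val hY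
    have h1 := hpos (((‖(Y : H →L[ℂ] H)‖ : ℝ) : ℂ) • 1 - Y) (by
      rw [← ContinuousLinearMap.nonneg_iff_isPositive]
      have := hY'.le_algebraMap_norm_self
      rw [Algebra.algebraMap_eq_smul_one, ← Complex.coe_smul] at this
      exact sub_nonneg.2 this)
    rw [map_sub, map_smul, hm.map_one, star_sub, star_smul, star_one] at h1
    simpa using h1
  have hdecomp := realPart_add_I_smul_imaginaryPart X
  have hre := hsa _ (realPart X).2
  have him := hsa _ (imaginaryPart X).2
  have hre' : star (realPart X : M.toStarSubalgebra) = realPart X := (realPart X).2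
  have him' : star (imaginaryPart X : M.toStarSubalgebra) = imaginaryPart X := (imaginaryPart X).2
  rw [← hdecomp]
  simp only [star_add, star_smul, map_add, map_smul, hre, him, hre', him']

end PositiveMaps

/-! ### Reduction of each condition to commuting corners. -/

namespace GradedNet

variable {d : ℕ} {H : Type*} [NormedAddCommGroup H] [InnerProductSpace ℂ H] [CompleteSpace H]

/-- The corners by `E` of the dual net and of the twisted net commute at spacelike separation. -/
def CornersCommute (F : GradedNet d H) (E : H →L[ℂ] H) : Prop :=
  ∀ O O₁ : DoubleCone d, O₁.Spacelike O → ∀ A ∈ F.dual.algebra O, ∀ Y ∈ twist F.k (F.sets O₁),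
    Commute (E * A * E) (E * Y * E)

variable {E : H →L[ℂ] H}

theorem twist_corner (F : GradedNet d H) (hEk : Commute E F.k) (O : DoubleCone d) :
    twist F.k (corner E F.sets O) = (fun A => E * A * E) '' twist F.k (F.sets O) :=
  twist_image F.k_mul_k (F.isGraded O) (cornerMap E) (cornerMap_mul_left hEk)
    (cornerMap_mul_right hEk)

theorem corner_dual_subset_iff (F : GradedNet d H) (hEk : Commute E F.k) :
    (∀ O : DoubleCone d, corner E F.dual.sets O ⊆ twistedDual F.k (corner E F.sets) O) ↔
      F.CornersCommute E := by
  constructor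
  · intro h O O₁ hO A hA Y hY
    have h1 := h O ⟨A, hA, rfl⟩
    simp only [twistedDual, Set.mem_iInter] at h1
    exact (h1 O₁ hO (E * Y * E) (by rw [twist_corner F hEk]; exact ⟨Y, hY, rfl⟩)).symm
  · rintro h O _ ⟨A, hA, rfl⟩
    simp only [twistedDual, Set.mem_iInter]
    intro O₁ hO
    rw [twist_corner F hEk]
    rintro _ ⟨Y, hY, rfl⟩
    exact (h O O₁ hO A hA Y hY).symm

theorem CornersCommute.dual {F : GradedNet d H} (h : F.CornersCommute E)
    (hF : F.dual.dual = F) (hEk : Commute E F.k) : F.dual.CornersCommute E := by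
  intro O O₁ hO A hA Y hY
  rw [hF] at hA
  have hgr : IsGraded F.k (corner E F.sets O) :=
    (F.isGraded O).image (cornerMap E) fun A => by
      rw [cornerMap_mul_right hEk, cornerMap_mul_left hEk]
  refine commute_twist_symm F.k_mul_k (S := corner E F.dual.sets O₁) hgr ?_ _ ⟨A, hA, rfl⟩ _ ?_
  · rintro _ ⟨B, hB, rfl⟩
    rw [twist_corner F hEk]
    rintro _ ⟨Z, hZ, rfl⟩
    exact h O₁ O hO.symm B hB Z hZ
  · have := F.dual.twist_corner hEk O₁
    change twist F.k (corner E F.dual.sets O₁) = _ at this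
    rw [this]
    exact ⟨Y, hY, rfl⟩

/-- The inclusion `⊆` always holds, by extension of operators from `E H`; the inclusion `⊇` is the
commutation of corners itself. -/
theorem twistedDual_compressedNet_eq_iff {F : GradedNet d H} (hd : 2 ≤ d)
    (hE : IsStarProjection E) (hEk : Commute E F.k) (hcyc : IsCyclicFor E F.sets) :
    twistedDual (compress E F.k) (compressedNet E F.sets) = compressedNet E F.dual.sets ↔
      F.CornersCommute E := by
  have hE2 : E * E = E := hE.isIdempotentElem
  have htwist : ∀ O, twist (compress E F.k) (compressedNet E F.sets O) =
      compress E '' twist F.k (F.sets O) := fun O =>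
    twist_image F.k_mul_k (F.isGraded O) (compressMap E) (compress_mul_left hE2 hEk)
      (compress_mul_right hE2 hEk)
  have hmem : ∀ O (X : H →L[ℂ] H),
      compress E X ∈ twistedDual (compress E F.k) (compressedNet E F.sets) O ↔
        ∀ O₁ : DoubleCone d, O₁.Spacelike O → ∀ Y ∈ twist F.k (F.sets O₁),
          Commute (E * X * E) (E * Y * E) := by
    intro O X
    simp only [twistedDual, Set.mem_iInter, htwist]
    refine forall₂_congr fun O₁ _ => ?_
    simp only [Set.mem_centralizer_iff, Set.forall_mem_image, ← commute_compress_iff hE2]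
    exact forall₂_congr fun Y _ => eq_comm
  constructor
  · intro h O O₁ hO A hA Y hY
    refine (hmem O A).1 ?_ O₁ hO Y hY
    rw [h]
    exact ⟨A, hA, rfl⟩
  · intro h
    funext O
    refine Set.Subset.antisymm (fun X hX => ?_) ?_
    · rw [← compress_extendRange hE2 X, hmem, mul_extendRange hE2, extendRange_mul hE2] at hX
      obtain ⟨T, hT, hTE, -⟩ := exists_mem_dual_extension hd hE hEk hcyc
        (mul_extendRange hE2 X) (extendRange_mul hE2 X) hX
      refine ⟨T, hT, ?_⟩
      rw [← compress_extendRange hE2 X, compress_eq_compress_iff hE2, mul_assoc, hTE, mul_assoc,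
        extendRange_mul hE2]
    · rintro _ ⟨A, hA, rfl⟩
      exact (hmem O A).2 fun O₁ hO Y hY => h O O₁ hO A hA Y hY

theorem cornersCommute_of_hasConditionalExpectationFor {F : GradedNet d H}
    (hE : IsStarProjection E) (h : HasConditionalExpectationFor F.dual E) :
    F.CornersCommute E := by
  have hE1 : star E = E := hE.isSelfAdjoint
  have hE2 : E * E = E := hE.isIdempotentElem
  obtain ⟨m, hm⟩ := h
  intro O O₁ hO A hA Y hY
  set T := m.map O ⟨A, hA⟩ with hT
  have hTE : (T : H →L[ℂ] H) * E = E * A * E := hm O ⟨A, hA⟩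
  -- The adjoint of the defining relation for `star A`; so `m(A)` commutes with `E`.
  have hET : E * (T : H →L[ℂ] H) = E * A * E := by
    have h1 := hm O (star ⟨A, hA⟩)
    rw [(m.isConditionalExpectation O).map_star] at h1
    have h2 := congrArg star h1
    simpa [hE1, mul_assoc] using h2
  have hTY : Y * (T : H →L[ℂ] H) = T * Y := F.mem_dual_iff.1 T.2 O₁ hO Y hY
  have e1 : E * A * E * (E * Y * E) = E * T * Y * E := by
    rw [← hET, mul_assoc E, ← mul_assoc (T : H →L[ℂ] H), ← mul_assoc (T : H →L[ℂ] H), hTE, ← hET]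
    simp only [← mul_assoc, hE2]
  have e2 : E * Y * E * (E * A * E) = E * T * Y * E := by
    calc E * Y * E * (E * A * E) = E * Y * (E * E * A * E) := by simp only [mul_assoc]
      _ = E * (Y * T) * E := by rw [hE2, ← hTE]; simp only [mul_assoc]
      _ = _ := by rw [hTY]; simp only [mul_assoc]
  exact e1.trans e2.symm

/-- `m(A)` is the unique element of `F^d(O)` with `m(A) E = E A E`. Since `E` is separating for
`F^d`, all identities may be checked after right multiplication by `E`. -/
theorem CornersCommute.hasConditionalExpectationFor {F : GradedNet d H} (hd : 2 ≤ d)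
    (hE : IsStarProjection E) (hEk : Commute E F.k) (hcyc : IsCyclicFor E F.sets)
    (h : F.CornersCommute E) : HasConditionalExpectationFor F.dual E := by
  have hE1 : star E = E := hE.isSelfAdjoint
  have hE2 : E * E = E := hE.isIdempotentElem
  have ext : ∀ (O : DoubleCone d) (A : (F.dual.algebra O).toStarSubalgebra),
      ∃ T : (F.dual.algebra O).toStarSubalgebra,
        (T : H →L[ℂ] H) * E = E * A * E ∧ E * (T : H →L[ℂ] H) = E * A * E := by
    intro O A
    obtain ⟨T, hT, h'⟩ := exists_mem_dual_extension hd hE hEk hcyc (O := O) (X := E * A * E)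
      (by simp only [← mul_assoc, hE2]) (by rw [mul_assoc, hE2])
      (fun O₁ hO Y hY => h O O₁ hO A A.2 Y hY)
    exact ⟨⟨T, hT⟩, h'⟩
  choose m hmE hEm using ext
  have uniq : ∀ {O : DoubleCone d} {S T : (F.dual.algebra O).toStarSubalgebra},
      (S : H →L[ℂ] H) * E = T * E → S = T := fun {O S T} hST =>
    Subtype.ext (eq_of_mem_dual (by omega) hEk hcyc S.2 T.2 hST)
  -- The square root of `E X E` also commutes with the corners of the twist, so it extends to some
  -- `T` in `F^d(O)`, and `m(X) = T* T` by uniqueness.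
  have pos : ∀ (O) (X : (F.dual.algebra O).toStarSubalgebra), (X : H →L[ℂ] H).IsPositive → (m O X : H →L[ℂ] H).IsPositive := by
    intro O X hX
    set Q : H →L[ℂ] H := E * X * E with hQ
    have hQ0 : 0 ≤ Q := by
      have := star_left_conjugate_nonneg ((ContinuousLinearMap.nonneg_iff_isPositive _).2 hX) E
      rwa [hE1] at this
    set C := CFC.sqrt Q with hC
    have hCC : C * C = Q := CFC.sqrt_mul_sqrt_self Q hQ0
    have hCs : star C = C := (CFC.sqrt_nonneg Q).isSelfAdjoint
    have hcomm : ∀ Z : H →L[ℂ] H, Commute Q Z → Commute C Z := fun Z hZ => hZ.cfcₙ_nnreal _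
    have hEQ : E * Q = Q := by rw [hQ]; simp only [← mul_assoc, hE2]
    have hQE : Q * E = Q := by rw [hQ, mul_assoc, hE2]
    have hCE : Commute C E := hcomm E (hQE.trans hEQ.symm)
    obtain ⟨T, hT, hTE, hET⟩ := exists_mem_dual_extension hd hE hEk hcyc (O := O) (X := E * C)
      (by rw [← mul_assoc, hE2]) (by rw [mul_assoc, hCE.eq, ← mul_assoc, hE2])
      (fun O₁ hO Y hY => by
        refine Commute.mul_left ?_ (hcomm _ (h O O₁ hO X X.2 Y hY))
        show E * (E * Y * E) = E * Y * E * E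
        rw [mul_assoc _ E E, hE2, mul_assoc E Y, ← mul_assoc E E, hE2])
    have hTT : m O X = star ⟨T, hT⟩ * (⟨T, hT⟩ : (F.dual.algebra O).toStarSubalgebra) := by
      refine uniq ?_
      show (m O X : H →L[ℂ] H) * E = star T * T * E
      have hsT : star T * E = C * E := by
        rw [← hE1, ← star_mul, hET, star_mul, hCs, hE1]
      rw [hmE, ← hQ, mul_assoc, hTE, ← mul_assoc, hsT, hCE.eq, mul_assoc, hCC, hEQ]
    rw [hTT, ← ContinuousLinearMap.nonneg_iff_isPositive]
    exact star_mul_self_nonneg T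
  refine ⟨⟨fun O => ⟨⟨m O, fun A B => uniq ?_⟩, fun c A => uniq ?_⟩,
    fun O => ⟨fun X => uniq ?_, uniq ?_, pos O, fun X Y Z => uniq ?_⟩, fun O₁ O₂ hO X => ?_⟩, hmE⟩
  · simp [hmE, mul_add, add_mul]
  · simp [hmE]
  · show (m O (m O X) : H →L[ℂ] H) * E = m O X * E
    rw [hmE, hmE, hEm]
    simp only [mul_assoc, hE2]
  · show (m O 1 : H →L[ℂ] H) * E = 1 * E
    rw [hmE]
    simp [hE2]
  · show (m O (m O X * Y * m O Z) : H →L[ℂ] H) * E = m O X * m O Y * m O Z * E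
    have hcommE : ∀ A, E * (m O A : H →L[ℂ] H) = m O A * E := fun A => (hEm O A).trans (hmE O A).symm
    rw [hmE]
    show E * ((m O X : H →L[ℂ] H) * Y * m O Z) * E = _
    calc E * ((m O X : H →L[ℂ] H) * Y * m O Z) * E
        = (E * m O X) * Y * (m O Z * E) := by simp only [mul_assoc]
      _ = m O X * (E * Y * E) * m O Z := by
          rw [hcommE, ← hcommE Z]; simp only [mul_assoc]
      _ = m O X * m O Y * (E * m O Z) := by rw [← hmE]; simp only [mul_assoc]
      _ = _ := by rw [hcommE]; simp only [mul_assoc]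
  · refine eq_of_mem_dual (by omega) hEk hcyc (m O₂ _).2
      (F.dual.isotony O₁ O₂ hO (m O₁ X).2) ?_
    show (m O₂ _ : H →L[ℂ] H) * E = m O₁ X * E
    rw [hmE, hmE]

theorem hasConditionalExpectationFor_dual_iff {F : GradedNet d H} (hd : 2 ≤ d)
    (hE : IsStarProjection E) (hEk : Commute E F.k) (hcyc : IsCyclicFor E F.sets) :
    HasConditionalExpectationFor F.dual E ↔ F.CornersCommute E :=
  ⟨cornersCommute_of_hasConditionalExpectationFor hE,
    CornersCommute.hasConditionalExpectationFor hd hE hEk hcyc⟩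

end GradedNet
end

/-! ### The equivalence of the six conditions. -/

theorem corollary3p3 {d : ℕ} (hd : 2 ≤ d)
    {H : Type*} [NormedAddCommGroup H] [InnerProductSpace ℂ H] [CompleteSpace H]
    (F : GradedNet d H) (hF : F.dual.dual = F)
    (E : H →L[ℂ] H) (hE : IsStarProjection E) (hEk : Commute E F.k)
    (hcyc : IsCyclicFor E F.sets) (hcyc_dual : IsCyclicFor E F.dual.sets) :
    List.TFAE [
      HasConditionalExpectationFor F E,
      HasConditionalExpectationFor F.dual E,
      ∀ O : DoubleCone d, corner E F.sets O ⊆ twistedDual F.k (corner E F.dual.sets) O,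
      ∀ O : DoubleCone d, corner E F.dual.sets O ⊆ twistedDual F.k (corner E F.sets) O,
      twistedDual (compress E F.k) (compressedNet E F.sets) = compressedNet E F.dual.sets,
      twistedDual (compress E F.k) (compressedNet E F.dual.sets) = compressedNet E F.sets] := by
  have hEk' : Commute E F.dual.k := hEk
  have hP : F.dual.CornersCommute E ↔ F.CornersCommute E := by
    refine ⟨fun h => ?_, fun h => h.dual hF hEk⟩
    have := h.dual (congrArg GradedNet.dual hF) hEk'
    rwa [hF] at this
  have ha := GradedNet.hasConditionalExpectationFor_dual_iff hd hE hEk' hcyc_dual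
  have ha' := GradedNet.hasConditionalExpectationFor_dual_iff hd hE hEk hcyc
  have hb := F.dual.corner_dual_subset_iff hEk'
  have hb' := F.corner_dual_subset_iff hEk
  have hc := GradedNet.twistedDual_compressedNet_eq_iff hd hE hEk hcyc
  have hc' := GradedNet.twistedDual_compressedNet_eq_iff hd hE hEk' hcyc_dual
  -- The statements for `F^d` become statements about `F^dd = F`, governed by the same commutation
  -- property.
  rw [hF, hP] at ha hb hc'
  tfae_have 1 ↔ 4 := ha.trans hb'.symm
  tfae_have 2 ↔ 4 := ha'.trans hb'.symm
  tfae_have 3 ↔ 4 := hb.trans hb'.symm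
  tfae_have 5 ↔ 4 := hc.trans hb'.symm
  tfae_have 6 ↔ 4 := hc'.trans hb'.symm
  tfae_finish
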